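/- Let $\mathbf k$ be a field, $n\ge 1$, $X=\{x_1,\dots,x_n\}$ with $x_1<x_2<\cdots<x_n$, and let $<$ be the degree-lexicographic order on the set $X^*$ of words in $X$ (words are compared first by length $|\cdot|$, then lexicographically from the left). For a permutation $\sigma$ of $\{1,\dots,n\}$ put $\mathbf x_\sigma=x_{\sigma(1)}x_{\sigma(2)}\cdots x_{\sigma(n)}$, and $\mathbf x_\varepsilon=x_1x_2\cdots x_n$, where $\varepsilon$ is the identity permutation. For a word $u$ let $\underline{u}$ denote the word with the same letters (with multiplicities) written in non-decreasing order. Let $\widetilde S\subseteq\mathbf k\langle X\rangle$ be the set of all of the following elements of the free associative algebra: 1. $\mathbf x_\sigma-\mathbf x_\varepsilon$, with $\sigma\ne\varepsilon$; 2. $x_i\mathbf x_\varepsilon-\mathbf x_\varepsilon x_i$; 3. $x_ix_1^m\mathbf x_\varepsilon-x_1^m\mathbf x_\varepsilon x_i$; 4. $\mathbf x_\varepsilon x_{i_1}\cdots x_{i_{m+1}}-\mathbf x_\varepsilon\,\underline{x_{i_1}\cdots x_{i_{m+1}}}$, with $x_{i_1}\cdots x_{i_{m+1}}>\underline{x_{i_1}\cdots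 x_{i_{m+1}}}$; 5. $\mathbf x_\varepsilon x_{i_1}\cdots x_{i_m}x_1-x_1\mathbf x_\varepsilon x_{i_1}\cdots x_{i_m}$; where $m\ge1$ and $2\le i,i_1,\dots,i_{m+1}\le n$. Then $\widetilde S$ is a Gröbner–Shirshov basis in $\mathbf k\langle X\rangle$ with respect to $<$. That is, writing $\bar f$ for the leading ($<$-largest) word of $f\neq 0$: every element of $\widetilde S$ is monic (its leading word has coefficient $1$), and for all $f,g\in\widetilde S$, (i) whenever $w=\bar f b=a\bar g$ with $a,b\in X^*$ and $|\bar f|+|\bar g|>|w|$, the intersection composition $fb-ag$ is trivial modulo $(\widetilde S,w)$; (ii) whenever $w=\bar f=a\bar g b$ with $a,b\in X^*$, the inclusion composition $f-agb$ is trivial modulo $(\widetilde S,w)$. Here $p\in\mathbf k\langle X\rangle$ is trivial modulo $(\widetilde S,w)$ if $p=\sum_j\alpha_ja_js_jb_j$ is a finite sum with $\alpha_j\in\mathbf k$, $a_j,b_j\in X^*$, $s_j\in\widetilde S$ and $a_j\overline{s_j}\,b_j<w$ for all $j$. -/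

import Mathlib

/-!
Words over an alphabet `X` are elements of the free monoid `FreeMonoid X`, and the free associative
algebra `k⟨X⟩` is the monoid algebra of the free monoid over `k`, so that the words form its
standard `k`-basis.  Monomial orders are given by their strict relation `r`, where `r u v` means
`u < v`.
-/

namespace GroebnerShirshov

/-- The free associative algebra `k⟨X⟩`. -/
abbrev FreeAssoc (k X : Type*) [Field k] : Type _ := MonoidAlgebra k (FreeMonoid X)

section General

variable {k X : Type*} [Field k]

/-- A word, regarded as an element of `k⟨X⟩`. -/
noncomputable def word (k : Type*) {X : Type*} [Field k] (u : FreeMonoid X) : FreeAssoc k X :=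
  MonoidAlgebra.single u 1

/-- `u` is the leading word of `f`: it occurs in `f` and every other word occurring in `f` is
smaller. -/
def IsLeadingWord (r : FreeMonoid X → FreeMonoid X → Prop) (f : FreeAssoc k X)
    (u : FreeMonoid X) : Prop :=
  u ∈ f.coeff.support ∧ ∀ v ∈ f.coeff.support, v ≠ u → r v u

/-- `f` is nonzero and its leading word has coefficient `1`. -/
def IsMonic (r : FreeMonoid X → FreeMonoid X → Prop) (f : FreeAssoc k X) : Prop :=
  ∃ u, IsLeadingWord r f u ∧ f.coeff u = 1

/-- `p` is trivial modulo `(S, w)`: it is a finite sum `∑ αᵢ aᵢ sᵢ bᵢ` with `αᵢ ∈ k`, words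
`aᵢ, bᵢ` and `sᵢ ∈ S`, such that `aᵢ s̄ᵢ bᵢ < w`, where `s̄ᵢ` is the leading word of `sᵢ`. -/
def TrivialMod (r : FreeMonoid X → FreeMonoid X → Prop) (S : Set (FreeAssoc k X))
    (w : FreeMonoid X) (p : FreeAssoc k X) : Prop :=
  p ∈ Submodule.span k
    {q : FreeAssoc k X | ∃ a b u : FreeMonoid X, ∃ s ∈ S,
      IsLeadingWord r s u ∧ r (a * u * b) w ∧ q = word k a * s * word k b}

/-- A set `S` of monic polynomials of `k⟨X⟩`, where the words are well ordered by `r`, is a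
Gröbner–Shirshov basis if all compositions of elements of `S` are trivial. -/
structure IsGroebnerShirshovBasis (r : FreeMonoid X → FreeMonoid X → Prop)
    [IsWellOrder (FreeMonoid X) r] (S : Set (FreeAssoc k X)) : Prop where
  /-- Every element of `S` is monic. -/
  monic : ∀ s ∈ S, IsMonic r s
  /-- Intersection compositions: `w = f̄ b = a ḡ` with `|f̄| + |ḡ| > |w|`. -/
  intersection : ∀ f ∈ S, ∀ g ∈ S, ∀ u v w a b : FreeMonoid X,
    IsLeadingWord r f u → IsLeadingWord r g v → w = u * b → w = a * v →
    w.length < u.length + v.length →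
    TrivialMod r S w (f * word k b - word k a * g)
  /-- Inclusion compositions: `w = f̄ = a ḡ b`. -/
  inclusion : ∀ f ∈ S, ∀ g ∈ S, ∀ u v w a b : FreeMonoid X,
    IsLeadingWord r f u → IsLeadingWord r g v → w = u → w = a * v * b →
    TrivialMod r S w (f - word k a * g * word k b)

end General

/-- The (strict) degree-lexicographic order on words over a linearly ordered alphabet: words are
compared first by length and then lexicographically from the left. -/
def DegLex {X : Type*} [LinearOrder X] (u v : FreeMonoid X) : Prop :=
  List.Shortlex (· < ·) u.toList v.toList

/-- The degree-lexicographic order over a well-ordered alphabet is a well order. -/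
instance DegLex.isWellOrder (X : Type*) [LinearOrder X] [WellFoundedLT X] :
    IsWellOrder (FreeMonoid X) DegLex where
  wf := List.Shortlex.wf wellFounded_lt
  trichotomous := (List.Shortlex.trichotomous (r := ((· < ·) : X → X → Prop))).trichotomous

section PermutationRelations

/- The alphabet is `Fin n` with its usual order; the letter `xᵢ` (`1 ≤ i ≤ n`) is the element `i - 1`
of `Fin n`.  In particular `x₁` is `0 : Fin n`, and `xᵢ` with `2 ≤ i` are those with `0 < i`. -/

variable {n : ℕ}

/-- The word `x_σ = x_{σ(1)} x_{σ(2)} ⋯ x_{σ(n)}`. -/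
def permWord (σ : Equiv.Perm (Fin n)) : FreeMonoid (Fin n) :=
  FreeMonoid.ofList (List.ofFn fun i => σ i)

/-- The word `x_ε = x₁ x₂ ⋯ xₙ`. -/
def epsWord (n : ℕ) : FreeMonoid (Fin n) := permWord 1

/-- The word with the same letters as `w`, with multiplicities, in non-decreasing order. -/
def sortWord (w : FreeMonoid (Fin n)) : FreeMonoid (Fin n) :=
  FreeMonoid.ofList (w.toList.insertionSort (· ≤ ·))

/-- The letters of `w` are among `x₂, …, xₙ`. -/
def AvoidsFirst [NeZero n] (w : FreeMonoid (Fin n)) : Prop := ∀ i ∈ w.toList, 0 < i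

variable (k : Type*) [Field k] (n)

/-- `x_σ - x_ε`, `σ ≠ ε`. -/
def family₁ : Set (FreeAssoc k (Fin n)) :=
  {p | ∃ σ : Equiv.Perm (Fin n), σ ≠ 1 ∧ p = word k (permWord σ) - word k (epsWord n)}

/-- `xᵢ x_ε - x_ε xᵢ`, `2 ≤ i ≤ n`. -/
def family₂ [NeZero n] : Set (FreeAssoc k (Fin n)) :=
  {p | ∃ i : Fin n, 0 < i ∧
    p = word k (FreeMonoid.of i * epsWord n) - word k (epsWord n * FreeMonoid.of i)}

/-- `xᵢ x₁ᵐ x_ε - x₁ᵐ x_ε xᵢ`, `2 ≤ i ≤ n`, `m ≥ 1`. -/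
def family₃ [NeZero n] : Set (FreeAssoc k (Fin n)) :=
  {p | ∃ (i : Fin n) (m : ℕ), 0 < i ∧ 1 ≤ m ∧
    p = word k (FreeMonoid.of i * FreeMonoid.of 0 ^ m * epsWord n)
      - word k (FreeMonoid.of 0 ^ m * epsWord n * FreeMonoid.of i)}

/-- `x_ε w - x_ε sort(w)`, where `w` is a word in `x₂, …, xₙ` of length at least `2` with
`w > sort(w)`. -/
def family₄ [NeZero n] : Set (FreeAssoc k (Fin n)) :=
  {p | ∃ w : FreeMonoid (Fin n), AvoidsFirst w ∧ 2 ≤ w.length ∧ DegLex (sortWord w) w ∧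
    p = word k (epsWord n * w) - word k (epsWord n * sortWord w)}

/-- `x_ε w x₁ - x₁ x_ε w`, where `w` is a nonempty word in `x₂, …, xₙ`. -/
def family₅ [NeZero n] : Set (FreeAssoc k (Fin n)) :=
  {p | ∃ w : FreeMonoid (Fin n), AvoidsFirst w ∧ 1 ≤ w.length ∧
    p = word k (epsWord n * w * FreeMonoid.of 0) - word k (FreeMonoid.of 0 * epsWord n * w)}

/-- The set `S̃`. -/
def sTilde [NeZero n] : Set (FreeAssoc k (Fin n)) :=
  family₁ n k ∪ family₂ n k ∪ family₃ n k ∪ family₄ n k ∪ family₅ n k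

end PermutationRelations

end GroebnerShirshov

/-!
Every element of `S̃` is a binomial `l - r` of words with `r < l`, so `S̃` is a string rewriting
system `l → r`, and if `p, q < w` rewrite to a common word, then `p - q` is trivial modulo
`(S̃, w)`: each rewriting step only involves words below `w`. A composition is a difference
`p - q` of two such words, so it suffices that `p` and `q` have a common reduct, and this can be
decided by an invariant, without going through the overlaps of the families one by one.

Call a word *full* if some `x_σ` is a factor of it. In every rule `l → r`, the
word `r` is full (`Rule.isFull_right`) and has the same letters, with multiplicities, as `l`
(`Rule.perm_toList`); hence the two words of a composition, which arise from `w` by one rewriting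
step each, are full and have the same letters. Conversely, a full word reduces to `x₁ᵐ x_ε v` with `v` a
non-decreasing word in `x₂, …, xₙ` (`IsFull.exists_reduces`): the factor `x_σ` becomes `x_ε`, it
moves left past the letters other than `x₁`, the letters `x₁` on its right move to the far
left, and what is left on its right is sorted. Here `m` and `v` are determined by the multiset of
letters of the word (`normalForm_unique`), so that two full words with the same letters have a
common reduct (`IsFull.trivialMod_sub`).
-/

namespace GroebnerShirshov

open FreeMonoid Relation

/-! ### The degree-lexicographic order -/

section DegLex

variable {X : Type*} [LinearOrder X]

theorem DegLex.asymm {u v : FreeMonoid X} (h : DegLex u v) : ¬ DegLex v u :=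
  (List.Shortlex.asymm (r := ((· < ·) : X → X → Prop))).asymm _ _ h

theorem DegLex.trans [WellFoundedLT X] {u v w : FreeMonoid X} (h : DegLex u v)
    (h' : DegLex v w) : DegLex u w :=
  _root_.trans h h'

theorem DegLex.mul_left {u v : FreeMonoid X} (h : DegLex u v) (a : FreeMonoid X) :
    DegLex (a * u) (a * v) :=
  List.Shortlex.append_left h a.toList

theorem DegLex.mul_right {u v : FreeMonoid X} (h : DegLex u v) (b : FreeMonoid X) :
    DegLex (u * b) (v * b) := by
  have lex_append : ∀ s t : List X, s.length = t.length → List.Lex (· < ·) s t →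
      List.Lex (· < ·) (s ++ b.toList) (t ++ b.toList) := by
    intro s t hl hlex
    induction hlex with
    | nil => simp at hl
    | cons _ ih => exact .cons (ih (by simpa using hl))
    | rel h => exact .rel h
  rcases List.shortlex_def.mp h with h | ⟨hl, h⟩
  · exact .of_length_lt (by simpa using h)
  · exact .of_lex (by simp [hl]) (lex_append _ _ hl h)

theorem degLex_of_mul {x y : X} {u v : FreeMonoid X} (h : x < y)
    (hl : u.length = v.length) : DegLex (of x * u) (of y * v) :=
  .of_lex (congrArg (· + 1) hl) (.rel h)

/-- A non-decreasing word is the smallest among its rearrangements. -/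
theorem degLex_of_perm {u v : FreeMonoid X} (hp : u.toList.Perm v.toList)
    (hu : u.toList.Pairwise (· ≤ ·)) (hne : u ≠ v) : DegLex u v := by
  have key : ∀ s t : List X, s.Perm t → s.Pairwise (· ≤ ·) → s ≠ t → List.Lex (· < ·) s t := by
    intro s
    induction s with
    | nil =>
      intro t hp _ hne
      exact absurd hp.nil_eq hne
    | cons a s ih =>
      intro t hp hs hne
      cases t with
      | nil => simp at hp
      | cons b t =>
        obtain ⟨ha, hs⟩ := List.pairwise_cons.mp hs
        by_cases hab : a = b
        · subst hab
          exact .cons (ih t hp.cons_inv hs fun h => hne (by rw [h]))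
        · refine .rel (lt_of_le_of_ne ?_ hab)
          rcases List.mem_cons.mp (hp.mem_iff.mpr (List.mem_cons_self (a := b))) with h | h
          · exact h.ge
          · exact ha b h
  exact .of_lex hp.length_eq (key _ _ hp hu hne)

end DegLex

/-! ### Leading words of binomials -/

section Binomials

variable {k X : Type*} [Field k]

theorem word_mul (u v : FreeMonoid X) : word k (u * v) = word k u * word k v := by
  simp [word, MonoidAlgebra.single_mul_single]

theorem isLeadingWord_binomial {r : FreeMonoid X → FreeMonoid X → Prop} {u v : FreeMonoid X}
    (h : r v u) (hne : v ≠ u) :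
    IsLeadingWord r (word k u - word k v) u ∧ (word k u - word k v).coeff u = 1 := by
  classical
  have hu : (word k u - word k v).coeff u = 1 := by
    simp [word, hne]
  refine ⟨⟨Finsupp.mem_support_iff.mpr (by rw [hu]; exact one_ne_zero), fun x hx hxu => ?_⟩, hu⟩
  have hxv : x = v := by
    by_contra hxv
    simp [word, Ne.symm hxu, Ne.symm hxv] at hx
  exact hxv ▸ h

theorem IsLeadingWord.eq [LinearOrder X] {f : FreeAssoc k X} {u v : FreeMonoid X}
    (hu : IsLeadingWord DegLex f u) (hv : IsLeadingWord DegLex f v) : u = v := by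
  by_contra h
  exact (hu.2 v hv.1 (Ne.symm h)).asymm (hv.2 u hu.1 h)

end Binomials

/-! ### Full words -/

variable {n : ℕ}

/-- A word is full if it has a factor `x_σ`, that is, a factor in which every letter occurs
exactly once. -/
def IsFull (u : FreeMonoid (Fin n)) : Prop :=
  ∃ a p b : FreeMonoid (Fin n), p.toList.Perm (List.finRange n) ∧ u = a * p * b

theorem IsFull.mul_left {u : FreeMonoid (Fin n)} (h : IsFull u) (a : FreeMonoid (Fin n)) :
    IsFull (a * u) := by
  obtain ⟨c, p, d, hp, rfl⟩ := h
  exact ⟨a * c, p, d, hp, by simp only [mul_assoc]⟩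

theorem IsFull.mul_right {u : FreeMonoid (Fin n)} (h : IsFull u) (b : FreeMonoid (Fin n)) :
    IsFull (u * b) := by
  obtain ⟨c, p, d, hp, rfl⟩ := h
  exact ⟨c, p, d * b, hp, by simp only [mul_assoc]⟩

theorem toList_epsWord : (epsWord n).toList = List.finRange n := by
  simp [epsWord, permWord, List.finRange]

theorem permWord_perm (σ : Equiv.Perm (Fin n)) :
    (permWord σ).toList.Perm (List.finRange n) := by
  have h := Equiv.Perm.ofFn_comp_perm σ (id : Fin n → Fin n)
  rw [List.ofFn_id] at h
  exact h

theorem permWord_injective : Function.Injective (permWord (n := n)) := by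
  intro σ τ h
  have h' : (fun i => σ i) = fun i => τ i := List.ofFn_injective (ofList.injective h)
  exact Equiv.ext (congrFun h')

theorem exists_permWord_eq {p : FreeMonoid (Fin n)} (hp : p.toList.Perm (List.finRange n)) :
    ∃ σ, p = permWord σ := by
  have hl : p.toList.length = n := by simpa using hp.length_eq
  have hnd : p.toList.Nodup := hp.nodup_iff.mpr (List.nodup_finRange n)
  have hinj : Function.Injective fun i : Fin n => p.toList.get (i.cast hl.symm) := fun i j h => by
    simpa using hnd.injective_get h
  refine ⟨Equiv.ofBijective _ (Finite.injective_iff_bijective.mp hinj), ?_⟩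
  apply toList.injective
  apply List.ext_get
  · simp [permWord, hl]
  · intro i h₁ h₂
    simp [permWord]

theorem isFull_epsWord : IsFull (epsWord n) :=
  ⟨1, epsWord n, 1, by rw [toList_epsWord], by simp⟩

/-! ### The rewriting system -/

variable [NeZero n]

/-- The rewriting rules `l → r` whose binomials `l - r` make up `S̃`, one constructor for each of
the five families. -/
inductive Rule : FreeMonoid (Fin n) → FreeMonoid (Fin n) → Prop
  | perm (σ : Equiv.Perm (Fin n)) (h : σ ≠ 1) : Rule (permWord σ) (epsWord n)
  | swap (i : Fin n) (h : 0 < i) : Rule (of i * epsWord n) (epsWord n * of i)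
  | swapPow (i : Fin n) (m : ℕ) (h : 0 < i) (hm : 1 ≤ m) :
      Rule (of i * of 0 ^ m * epsWord n) (of 0 ^ m * epsWord n * of i)
  | sort (w : FreeMonoid (Fin n)) (hw : AvoidsFirst w) (hl : 2 ≤ w.length)
      (h : DegLex (sortWord w) w) : Rule (epsWord n * w) (epsWord n * sortWord w)
  | first (w : FreeMonoid (Fin n)) (hw : AvoidsFirst w) (hl : 1 ≤ w.length) :
      Rule (epsWord n * w * of 0) (of 0 * epsWord n * w)

theorem mem_sTilde_iff {k : Type*} [Field k] {p : FreeAssoc k (Fin n)} :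
    p ∈ sTilde n k ↔ ∃ l r, Rule l r ∧ p = word k l - word k r := by
  constructor
  · rintro ((((⟨σ, h, rfl⟩ | ⟨i, h, rfl⟩) | ⟨i, m, h, hm, rfl⟩) | ⟨w, hw, hl, h, rfl⟩) |
      ⟨w, hw, hl, rfl⟩)
    exacts [⟨_, _, .perm σ h, rfl⟩, ⟨_, _, .swap i h, rfl⟩, ⟨_, _, .swapPow i m h hm, rfl⟩,
      ⟨_, _, .sort w hw hl h, rfl⟩, ⟨_, _, .first w hw hl, rfl⟩]
  · rintro ⟨l, r, h, rfl⟩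
    cases h with
    | perm σ h => exact .inl (.inl (.inl (.inl ⟨σ, h, rfl⟩)))
    | swap i h => exact .inl (.inl (.inl (.inr ⟨i, h, rfl⟩)))
    | swapPow i m h hm => exact .inl (.inl (.inr ⟨i, m, h, hm, rfl⟩))
    | sort w hw hl h => exact .inl (.inr ⟨w, hw, hl, h, rfl⟩)
    | first w hw hl => exact .inr ⟨w, hw, hl, rfl⟩

theorem Rule.perm_toList {l r : FreeMonoid (Fin n)} (h : Rule l r) :
    l.toList.Perm r.toList := by
  cases h with
  | perm σ h => rw [toList_epsWord]; exact permWord_perm σ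
  | swap i h => exact List.perm_append_comm
  | swapPow i m h hm =>
    rw [mul_assoc]
    exact List.perm_append_comm
  | sort w hw hl h => exact (List.perm_insertionSort _ _).symm.append_left _
  | first w hw hl =>
    rw [mul_assoc (of 0)]
    exact List.perm_append_comm

theorem Rule.isFull_right {l r : FreeMonoid (Fin n)} (h : Rule l r) : IsFull r := by
  cases h with
  | perm σ h => exact isFull_epsWord
  | swap i h => exact isFull_epsWord.mul_right _
  | swapPow i m h hm => exact (isFull_epsWord.mul_left _).mul_right _
  | sort w hw hl h => exact isFull_epsWord.mul_right _
  | first w hw hl => exact (isFull_epsWord.mul_left _).mul_right _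

theorem exists_epsWord_eq : ∃ t : FreeMonoid (Fin n), epsWord n = of 0 * t := by
  obtain ⟨m, rfl⟩ := Nat.exists_eq_succ_of_ne_zero (NeZero.ne n)
  refine ⟨ofList ((List.finRange m).map Fin.succ), ?_⟩
  apply toList.injective
  rw [toList_epsWord, List.finRange_succ]
  rfl

theorem exists_epsWord_eq_of_pos {i : Fin n} (hi : 0 < i) :
    ∃ (c : Fin n) (t : FreeMonoid (Fin n)), 0 < c ∧ epsWord n = of 0 * (of c * t) := by
  have hn : 2 ≤ n := by
    have := Fin.lt_def.mp hi
    have := i.isLt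
    omega
  obtain ⟨m, rfl⟩ := Nat.exists_eq_add_of_le' hn
  refine ⟨1, ofList (((List.finRange m).map Fin.succ).map Fin.succ), by simp, ?_⟩
  apply toList.injective
  rw [toList_epsWord, List.finRange_succ, List.finRange_succ]
  rfl

/-- The right side of a rule is smaller than its left side, so that the left side is the leading
word of the binomial. -/
theorem Rule.degLex {l r : FreeMonoid (Fin n)} (h : Rule l r) : DegLex r l := by
  have hlen : r.length = l.length := h.perm_toList.length_eq.symm
  cases h with
  | perm σ h =>
    refine degLex_of_perm (Rule.perm σ h).perm_toList.symm ?_ fun e => h (permWord_injective e.symm)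
    rw [toList_epsWord]
    exact (List.pairwise_lt_finRange n).imp le_of_lt
  | swap i h =>
    obtain ⟨t, ht⟩ := exists_epsWord_eq (n := n)
    rw [length_mul, length_mul] at hlen
    conv_lhs => rw [ht, mul_assoc]
    refine degLex_of_mul h ?_
    simp [ht, add_comm]
  | swapPow i m h hm =>
    obtain ⟨m, rfl⟩ := Nat.exists_eq_add_of_le' hm
    simp only [mul_assoc] at hlen ⊢
    rw [pow_succ', mul_assoc] at hlen ⊢
    refine degLex_of_mul h ?_
    simp [length_mul] at hlen ⊢
    omega
  | sort w hw hl h => exact h.mul_left _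
  | first w hw hl =>
    obtain ⟨i, hi⟩ := List.exists_mem_of_length_pos hl
    obtain ⟨c, t, hc, ht⟩ := exists_epsWord_eq_of_pos (hw i hi)
    rw [ht] at hlen ⊢
    simp only [mul_assoc] at hlen ⊢
    refine (degLex_of_mul hc ?_).mul_left _
    simp [length_mul] at hlen ⊢
    omega

/-- One application of a rule inside a word. -/
def Step (u v : FreeMonoid (Fin n)) : Prop :=
  ∃ a b l r, Rule l r ∧ u = a * l * b ∧ v = a * r * b

/-- The reflexive transitive closure of `Step`. -/
abbrev Reduces : FreeMonoid (Fin n) → FreeMonoid (Fin n) → Prop := ReflTransGen Step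

theorem Rule.reduces {l r : FreeMonoid (Fin n)} (h : Rule l r) : Reduces l r :=
  .single ⟨1, 1, l, r, h, by simp, by simp⟩

theorem Reduces.mul_left {u v : FreeMonoid (Fin n)} (h : Reduces u v) (c : FreeMonoid (Fin n)) :
    Reduces (c * u) (c * v) := by
  refine ReflTransGen.lift (c * ·) ?_ _ _ h
  rintro _ _ ⟨a, b, l, r, h, rfl, rfl⟩
  exact ⟨c * a, b, l, r, h, by simp only [mul_assoc], by simp only [mul_assoc]⟩

theorem Reduces.mul_right {u v : FreeMonoid (Fin n)} (h : Reduces u v) (c : FreeMonoid (Fin n)) :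
    Reduces (u * c) (v * c) := by
  refine ReflTransGen.lift (· * c) ?_ _ _ h
  rintro _ _ ⟨a, b, l, r, h, rfl, rfl⟩
  exact ⟨a, b * c, l, r, h, by simp only [mul_assoc], by simp only [mul_assoc]⟩

theorem Step.perm_toList {u v : FreeMonoid (Fin n)} (h : Step u v) :
    u.toList.Perm v.toList := by
  obtain ⟨a, b, l, r, h, rfl, rfl⟩ := h
  exact (h.perm_toList.append_left _).append_right _

theorem Reduces.perm_toList {u v : FreeMonoid (Fin n)} (h : Reduces u v) :
    u.toList.Perm v.toList := by
  induction h with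
  | refl => exact .refl _
  | tail _ h ih => exact ih.trans h.perm_toList

theorem Step.degLex {u v : FreeMonoid (Fin n)} (h : Step u v) : DegLex v u := by
  obtain ⟨a, b, l, r, h, rfl, rfl⟩ := h
  exact (h.degLex.mul_left a).mul_right b

/-- Reduction starting below `w` stays below `w`, so it does not change a word modulo
`(S̃, w)`. -/
theorem Reduces.trivialMod {k : Type*} [Field k] {u v w : FreeMonoid (Fin n)} (h : Reduces u v)
    (hw : DegLex u w) : TrivialMod DegLex (sTilde n k) w (word k u - word k v) := by
  induction h using ReflTransGen.head_induction_on with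
  | refl => rw [sub_self]; exact Submodule.zero_mem _
  | @head u c h _ ih =>
    rw [← sub_add_sub_cancel _ (word k c)]
    refine Submodule.add_mem _ (Submodule.subset_span ?_) (ih (h.degLex.trans hw))
    obtain ⟨a, b, l, r, h, rfl, rfl⟩ := h
    have hne : r ≠ l := fun e => (h.degLex).asymm (e ▸ h.degLex)
    exact ⟨a, b, l, _, mem_sTilde_iff.mpr ⟨l, r, h, rfl⟩,
      (isLeadingWord_binomial h.degLex hne).1, hw, by simp only [word_mul, mul_sub, sub_mul]⟩

/-! ### Normal forms of full words -/

theorem reduces_epsWord {p : FreeMonoid (Fin n)} (hp : p.toList.Perm (List.finRange n)) :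
    Reduces p (epsWord n) := by
  obtain ⟨σ, rfl⟩ := exists_permWord_eq hp
  by_cases h : σ = 1
  · rw [h]
    exact .refl
  · exact (Rule.perm σ h).reduces

/-- `x_ε x₁` reduces to `x₁ x_ε`, since `x_ε x₁ = x₁ x_σ` for the cycle `σ` with
`x_σ = x₂ ⋯ xₙ x₁`. -/
theorem epsWord_mul_of_zero_reduces :
    Reduces (epsWord n * of 0) (of 0 * epsWord n) := by
  obtain ⟨t, ht⟩ := exists_epsWord_eq (n := n)
  have hp : (t * of 0).toList.Perm (List.finRange n) := by
    rw [← toList_epsWord, ht]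
    exact List.perm_append_comm
  have h := (reduces_epsWord hp).mul_left (of 0)
  rwa [← mul_assoc, ← ht] at h

/-- `x_ε` moves to the left until only letters `x₁` precede it. -/
theorem mul_epsWord_reduces (a : FreeMonoid (Fin n)) :
    ∃ m w, Reduces (a * epsWord n) (of 0 ^ m * epsWord n * w) := by
  induction a using FreeMonoid.inductionOn' with
  | one => exact ⟨0, 1, by simpa using ReflTransGen.refl⟩
  | of_mul i a ih =>
    obtain ⟨m, w, h⟩ := ih
    replace h := h.mul_left (of i)
    rw [← mul_assoc] at h
    rcases eq_or_ne i 0 with rfl | hi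
    · exact ⟨m + 1, w, by rw [pow_succ']; simpa only [mul_assoc] using h⟩
    refine ⟨m, of i * w, h.trans ?_⟩
    have hpos : 0 < i := Fin.pos_iff_ne_zero.mpr hi
    have hr : Reduces (of i * of 0 ^ m * epsWord n) (of 0 ^ m * epsWord n * of i) := by
      rcases Nat.eq_zero_or_pos m with rfl | hm
      · simpa using (Rule.swap i hpos).reduces
      · exact (Rule.swapPow i m hpos hm).reduces
    simpa only [mul_assoc] using hr.mul_right w

/-- The letters `x₁` on the right of `x_ε` move to the far left. -/
theorem epsWord_mul_reduces (w : FreeMonoid (Fin n)) :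
    ∃ m v, AvoidsFirst v ∧ Reduces (epsWord n * w) (of 0 ^ m * epsWord n * v) := by
  have key : ∀ l : List (Fin n), ∃ m v, AvoidsFirst v ∧
      Reduces (epsWord n * ofList l) (of 0 ^ m * epsWord n * v) := by
    intro l
    induction l using List.reverseRecOn with
    | nil => exact ⟨0, 1, by simp [AvoidsFirst], by simpa using ReflTransGen.refl⟩
    | append_singleton l i ih =>
      obtain ⟨m, v, hv, h⟩ := ih
      replace h := h.mul_right (of i)
      rw [ofList_append, ofList_singleton, ← mul_assoc]
      rcases eq_or_ne i 0 with rfl | hi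
      · have hr : Reduces (epsWord n * v * of 0) (of 0 * epsWord n * v) := by
          rcases Nat.eq_zero_or_pos v.length with hl | hl
          · rw [length_eq_zero.mp hl]
            simpa using epsWord_mul_of_zero_reduces
          · exact (Rule.first v hv hl).reduces
        refine ⟨m + 1, v, hv, h.trans ?_⟩
        rw [pow_succ]
        simpa only [mul_assoc] using hr.mul_left (of 0 ^ m)
      · refine ⟨m, v * of i, fun j hj => ?_, by simpa only [mul_assoc] using h⟩
        rcases List.mem_append.mp hj with hj | hj
        · exact hv j hj
        · rw [List.mem_singleton.mp hj]
          exact Fin.pos_iff_ne_zero.mpr hi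
  exact key w.toList

theorem epsWord_mul_reduces_sortWord {w : FreeMonoid (Fin n)} (hw : AvoidsFirst w) :
    Reduces (epsWord n * w) (epsWord n * sortWord w) := by
  by_cases h : sortWord w = w
  · rw [h]
  refine (Rule.sort w hw ?_ (degLex_of_perm (List.perm_insertionSort _ _)
    (List.pairwise_insertionSort _ _) h)).reduces
  by_contra hl
  refine h (toList.injective (List.Pairwise.insertionSort_eq ?_))
  have hl' : w.toList.length ≤ 1 := by
    change ¬ 2 ≤ w.toList.length at hl
    omega
  match w.toList, hl' with
  | [], _ => exact .nil
  | [a], _ => exact List.pairwise_singleton _ a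

theorem IsFull.exists_reduces {u : FreeMonoid (Fin n)} (hu : IsFull u) :
    ∃ m v, AvoidsFirst v ∧ v.toList.Pairwise (· ≤ ·) ∧
      Reduces u (of 0 ^ m * epsWord n * v) := by
  obtain ⟨a, p, b, hp, rfl⟩ := hu
  obtain ⟨m, w, h₁⟩ := mul_epsWord_reduces a
  obtain ⟨m', v, hv, h₂⟩ := epsWord_mul_reduces (w * b)
  refine ⟨m + m', sortWord v, fun i hi => hv i ?_, List.pairwise_insertionSort _ _, ?_⟩
  · exact (List.perm_insertionSort _ _).mem_iff.mp hi
  refine (((reduces_epsWord hp).mul_left a).mul_right b).trans ((h₁.mul_right b).trans ?_)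
  have h₂' := h₂.mul_left (of 0 ^ m)
  have h₃ := (epsWord_mul_reduces_sortWord hv).mul_left (of 0 ^ m * of 0 ^ m')
  rw [pow_add]
  simp only [mul_assoc] at h₂' h₃ ⊢
  exact h₂'.trans h₃

/-- The normal form `x₁ᵐ x_ε v` is determined by its letters: the occurrences of `x₁` give `m`,
and the other letters give `v`. -/
theorem normalForm_unique {m m' : ℕ} {v v' : FreeMonoid (Fin n)}
    (hv : AvoidsFirst v) (hv' : AvoidsFirst v') (hs : v.toList.Pairwise (· ≤ ·))
    (hs' : v'.toList.Pairwise (· ≤ ·))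
    (h : (of 0 ^ m * epsWord n * v).toList.Perm (of 0 ^ m' * epsWord n * v').toList) :
    of 0 ^ m * epsWord n * v = of 0 ^ m' * epsWord n * v' := by
  have hpow : ∀ m : ℕ, (of (0 : Fin n) ^ m).toList.count 0 = m := by
    intro m
    induction m with
    | zero => rfl
    | succ m ih => simp [pow_succ, ih]
  have hcount : ∀ {w : FreeMonoid (Fin n)}, AvoidsFirst w → w.toList.count 0 = 0 := fun hw =>
    List.count_eq_zero.mpr fun h0 => lt_irrefl _ (hw 0 h0)
  have hm : m = m' := by
    have hc := h.count_eq 0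
    simp only [toList_mul, List.count_append, hpow, hcount hv, hcount hv'] at hc
    omega
  subst hm
  rw [toList.injective ((List.perm_append_left_iff _).mp h |>.eq_of_pairwise' hs hs')]

/-- Full words with the same letters have a common reduct. -/
theorem IsFull.trivialMod_sub {k : Type*} [Field k] {p q w : FreeMonoid (Fin n)} (hp : IsFull p)
    (hq : IsFull q) (h : p.toList.Perm q.toList) (hpw : DegLex p w) (hqw : DegLex q w) :
    TrivialMod DegLex (sTilde n k) w (word k p - word k q) := by
  obtain ⟨m, v, hv, hs, hr⟩ := hp.exists_reduces
  obtain ⟨m', v', hv', hs', hr'⟩ := hq.exists_reduces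
  rw [← normalForm_unique hv hv' hs hs' (hr.perm_toList.symm.trans (h.trans hr'.perm_toList))]
    at hr'
  have key := Submodule.sub_mem _ (hr.trivialMod (k := k) hpw) (hr'.trivialMod (k := k) hqw)
  rwa [sub_sub_sub_cancel_right] at key

/-! ### Compositions -/

theorem Rule.isLeadingWord {k : Type*} [Field k] {l r : FreeMonoid (Fin n)} (h : Rule l r) :
    IsLeadingWord DegLex (word k l - word k r) l ∧ (word k l - word k r).coeff l = 1 :=
  isLeadingWord_binomial h.degLex fun e => h.degLex.asymm (e ▸ h.degLex)

theorem exists_rule_of_isLeadingWord {k : Type*} [Field k] {f : FreeAssoc k (Fin n)}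
    {u : FreeMonoid (Fin n)} (hf : f ∈ sTilde n k) (hu : IsLeadingWord DegLex f u) :
    ∃ r, Rule u r ∧ f = word k u - word k r := by
  obtain ⟨l, r, h, rfl⟩ := mem_sTilde_iff.mp hf
  obtain rfl := hu.eq h.isLeadingWord.1
  exact ⟨r, h, rfl⟩

end GroebnerShirshov

open GroebnerShirshov in
theorem theorem3p2 (k : Type*) [Field k] (n : ℕ) [NeZero n] :
    GroebnerShirshov.IsGroebnerShirshovBasis
      (GroebnerShirshov.DegLex (X := Fin n)) (GroebnerShirshov.sTilde n k) := by
  refine ⟨fun s hs => ?_, fun f hf g hg u v w a b hu hv hwu hwv _ => ?_,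
    fun f hf g hg u v w a b hu hv hwu hwv => ?_⟩
  · obtain ⟨l, r, h, rfl⟩ := mem_sTilde_iff.mp hs
    exact ⟨l, h.isLeadingWord⟩
  · obtain ⟨r, hr, rfl⟩ := exists_rule_of_isLeadingWord hf hu
    obtain ⟨t, ht, rfl⟩ := exists_rule_of_isLeadingWord hg hv
    have heq : (word k u - word k r) * word k b - word k a * (word k v - word k t)
        = word k (a * t) - word k (r * b) := by
      rw [sub_mul, mul_sub, ← word_mul, ← word_mul, ← word_mul, ← word_mul, ← hwu, ← hwv]
      abel
    rw [heq]
    refine (ht.isFull_right.mul_left a).trivialMod_sub (hr.isFull_right.mul_right b) ?_ ?_ ?_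
    · have h₁ : w.toList.Perm (a * t).toList := hwv ▸ ht.perm_toList.append_left _
      have h₂ : w.toList.Perm (r * b).toList := hwu ▸ hr.perm_toList.append_right _
      exact h₁.symm.trans h₂
    · exact hwv ▸ ht.degLex.mul_left a
    · exact hwu ▸ hr.degLex.mul_right b
  · obtain ⟨r, hr, rfl⟩ := exists_rule_of_isLeadingWord hf hu
    obtain ⟨t, ht, rfl⟩ := exists_rule_of_isLeadingWord hg hv
    have heq : word k u - word k r - word k a * (word k v - word k t) * word k b
        = word k (a * t * b) - word k r := by
      rw [mul_sub, sub_mul, ← word_mul, ← word_mul, ← word_mul, ← word_mul, ← hwu, ← hwv]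
      abel
    rw [heq]
    refine ((ht.isFull_right.mul_left a).mul_right b).trivialMod_sub hr.isFull_right ?_ ?_ ?_
    · have h₁ : w.toList.Perm (a * t * b).toList :=
        hwv ▸ (ht.perm_toList.append_left _).append_right _
      have h₂ : w.toList.Perm r.toList := hwu ▸ hr.perm_toList
      exact h₁.symm.trans h₂
    · exact hwv ▸ (ht.degLex.mul_left a).mul_right b
    · exact hwu ▸ hr.degLex
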